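/- Let $(X,\|\cdot\|,\le)$ be a real Banach lattice and let $\tau$ be a Hausdorff locally convex topology on $X$, generated by a set $\mathscr P$ of seminorms, such that: $\tau$ is coarser than the norm topology; norm-bounded $\tau$-Cauchy sequences are $\tau$-convergent; $\|x\|=\sup\{|\varphi(x)|:\varphi\in(X,\tau)',\ \|\varphi\|\le 1\}$ for all $x\in X$; and $\tau$ is compatible with the lattice structure, i.e. $p(x)\le p(y)$ for all $p\in\mathscr P$ and $x,y\in X$ with $|x|\le|y|$. The seminorms in $\mathscr P$ are assumed to be bounded by a common multiple of the norm. The mixed topology $\gamma$ of $X$ is the locally convex topology generated by the set $\widetilde{\mathscr P}$ of all seminorms $x\mapsto\sup_{n}a_np_n(x)$ with $p_n\in\mathscr P$, $a_n\ge 0$, $a_n\to 0$. Let $(T(t))_{t\ge 0}$ be a positive $\tau$-bi-continuous semigroup on $X$: bounded positive operators with $T(0)=I$, $T(t+s)=T(t)T(s)$, $t\mapsto T(t)x$ $\tau$-continuous for every $x\in X$, $\|T(t)\|\le Me^{\omega t}$ for some $M\ge1$, $\omega\in\mathbb R$, and such that for every norm-bounded $\tau$-null sequence $(x_n)$ and every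 $t_0\ge0$ one has $T(s)x_n\to 0$ with respect to $\tau$ uniformly for $s\in[0,t_0]$. Its generator $A$ is given by $Ax=\tau\text{-}\lim_{t\to 0+}\frac{T(t)x-x}{t}$ on the set $D(A)$ of all $x$ for which this limit exists and $\sup_{0<t\le1}\frac{\|T(t)x-x\|}{t}<\infty$. Assume that $(X,\gamma)$ is complete and that $(T(t))_{t\ge0}$ is $\gamma$-locally equicontinuous: for some $t_0>0$ and every $p\in\widetilde{\mathscr P}$ there are $q\in\widetilde{\mathscr P}$ and $M\ge0$ with $p(T(t)x)\le Mq(x)$ for all $x\in X$, $t\in[0,t_0]$. Let $\mu\in\rho(A)\cap\mathbb R$ (for instance $\mu=0$ if $0\in\rho(A)$). Let $\mathcal X_0=\overline{D(A)}^{\|\cdot\|}$, let $\mathcal A_0$ be the part of $A$ in $\mathcal X_0$, and let $\mathcal X_{-1}$ be the completion of $\mathcal X_0$ for the norm $\|(\mathcal A_0-\mu)^{-1}x\|$. The operator $\mathcal A_0-\mu$ extends continuously to an isometric isomorphism $\mathcal A_{-1}-\mu:\mathcal X_0\to\mathcal X_{-1}$, and $X$ is regarded as a subspace of $\mathcal X_{-1}$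 by means of $x\mapsto(\mathcal A_{-1}-\mu)(A-\mu)^{-1}x$. The same construction, applied to $\mathcal A_{-1}$ on $\mathcal X_{-1}$, gives $\mathcal X_{-2}\supseteq\mathcal X_{-1}$ and $\mathcal A_{-2}-\mu:\mathcal X_{-1}\to\mathcal X_{-2}$. Let $X_{-1}:=(\mathcal A_{-2}-\mu)(X)\subseteq\mathcal X_{-2}$ be the extrapolation space of the semigroup (so $X\subseteq X_{-1}$), with norm $\|z\|_{-1}=\|(\mathcal A_{-2}-\mu)^{-1}z\|$ and with the topology $\tau_{-1}$ generated by $\mathscr P_{-1}=\{p_{-1}:p\in\mathscr P\}$, $p_{-1}(z)=p((\mathcal A_{-2}-\mu)^{-1}z)$. Let $\gamma_{-1}$ be the mixed topology of $X_{-1}$, i.e. the one generated by the seminorms $z\mapsto\sup_n a_nq_n(z)$ with $q_n\in\mathscr P_{-1}$, $a_n\ge0$, $a_n\to0$. Let $X_+=\{x\in X: x\ge0\}$ and let $X_{-1,+}$ be the $\gamma_{-1}$-closure of $X_+$ in $X_{-1}$. Then $X_{-1,+}$ is a $\gamma_{-1}$-closed convex cone in $X_{-1}$, that is, it is $\gamma_{-1}$-closed,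 $X_{-1,+}+X_{-1,+}\subseteq X_{-1,+}$, $\alpha X_{-1,+}\subseteq X_{-1,+}$ for all $\alpha\ge0$, and $X_{-1,+}\cap(-X_{-1,+})=\{0\}$. Moreover, $X_+=X_{-1,+}\cap X$. -/

import Mathlib

open Filter Topology Set

noncomputable section

namespace BiCont

/-! ### Locally convex topologies given by families of seminorms -/

section Seminorms

variable {E : Type*} [AddCommGroup E] [Module ℝ E]

/-- The uniform structure generated by a set of seminorms. -/
@[reducible]
def lcUniformity (P : Set (Seminorm ℝ E)) : UniformSpace E :=
  ⨅ p : P, (p : Seminorm ℝ E).toSeminormedAddCommGroup.toUniformSpace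

/-- The locally convex topology generated by a set of seminorms. -/
@[reducible]
def lcTopology (P : Set (Seminorm ℝ E)) : TopologicalSpace E :=
  (lcUniformity P).toTopologicalSpace

/-- The seminorms `x ↦ sup_n a_n p_n(x)` with `p_n ∈ P`, `a_n ≥ 0`, `a_n → 0`
(the supremum being an honest one). -/
def mixedSeminorms (P : Set (Seminorm ℝ E)) : Set (Seminorm ℝ E) :=
  {q | ∃ (a : ℕ → ℝ) (p : ℕ → Seminorm ℝ E), (∀ n, 0 ≤ a n) ∧ Tendsto a atTop (𝓝 0) ∧
    (∀ n, p n ∈ P) ∧ ∀ x, IsLUB (range fun n => a n * p n x) (q x)}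

/-- The uniform structure of the mixed topology `γ`. -/
@[reducible]
def mixedUniformity (P : Set (Seminorm ℝ E)) : UniformSpace E :=
  lcUniformity (mixedSeminorms P)

/-- The mixed topology `γ` of a normed space with a locally convex topology that is generated
by the set `P` of seminorms (the seminorms in `P` being bounded by a multiple of the norm). -/
@[reducible]
def mixedTopology (P : Set (Seminorm ℝ E)) : TopologicalSpace E :=
  lcTopology (mixedSeminorms P)

theorem tendsto_lcTopology {P : Set (Seminorm ℝ E)} {ι : Type*} {l : Filter ι} {f : ι → E}
    {y : E} : Tendsto f l (@nhds E (lcTopology P) y) ↔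
      ∀ p ∈ P, Tendsto (fun i => p (f i - y)) l (𝓝 0) := by
  have h : @nhds E (lcTopology P) y = ⨅ p : P, @nhds E
      (p : Seminorm ℝ E).toSeminormedAddCommGroup.toUniformSpace.toTopologicalSpace y := by
    rw [lcTopology, lcUniformity, UniformSpace.toTopologicalSpace_iInf, nhds_iInf]
  rw [h, tendsto_iInf]
  constructor
  · intro H p hp
    have h1 := H ⟨p, hp⟩
    let _ := p.toSeminormedAddCommGroup
    exact tendsto_iff_norm_sub_tendsto_zero.1 h1
  · intro H p
    have h1 := H p p.2
    let _ := (p : Seminorm ℝ E).toSeminormedAddCommGroup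
    exact tendsto_iff_norm_sub_tendsto_zero.2 h1

end Seminorms

/-! ### Bi-continuous semigroups -/

section Semigroups

variable {X : Type*} [NormedAddCommGroup X] [NormedSpace ℝ X]

/-- The standing assumptions on the norm of `X` and the locally convex topology `τ` generated
by `P`. -/
structure IsBiContSpace (P : Set (Seminorm ℝ X)) : Prop where
  /-- `τ` is Hausdorff. -/
  t2 : @T2Space X (lcTopology P)
  /-- `τ` is coarser than the norm topology. -/
  coarser : (inferInstance : TopologicalSpace X) ≤ lcTopology P
  /-- Norm-bounded `τ`-Cauchy sequences are `τ`-convergent. -/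
  seqComplete : ∀ x : ℕ → X, Bornology.IsBounded (range x) →
    @CauchySeq X ℕ (lcUniformity P) _ x → ∃ y, Tendsto x atTop (@nhds X (lcTopology P) y)
  /-- The dual of `(X, τ)` is norming. -/
  norming : ∀ x : X, IsLUB {r : ℝ | ∃ φ : X →L[ℝ] ℝ,
    @Continuous X ℝ (lcTopology P) _ φ ∧ ‖φ‖ ≤ 1 ∧ r = |φ x|} ‖x‖

/-- A `τ`-bi-continuous semigroup `(T(t))_{t ≥ 0}`, `τ` being generated by `P`. Only the values
of `T` at `t ≥ 0` matter. -/
structure BiContSemigroup (P : Set (Seminorm ℝ X)) where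
  /-- The operators of the semigroup. -/
  T : ℝ → X →L[ℝ] X
  space : IsBiContSpace P
  map_add : ∀ s t, 0 ≤ s → 0 ≤ t → T (t + s) = T t ∘L T s
  map_zero : T 0 = ContinuousLinearMap.id ℝ X
  /-- Strong `τ`-continuity. -/
  continuousOn : ∀ x, @ContinuousOn ℝ X _ (lcTopology P) (fun t => T t x) (Ici 0)
  /-- Exponential boundedness. -/
  expBounded : ∃ M : ℝ, 1 ≤ M ∧ ∃ ω : ℝ, ∀ t, 0 ≤ t → ‖T t‖ ≤ M * Real.exp (ω * t)
  /-- Local bi-equicontinuity. -/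
  biEquicontinuous : ∀ x : ℕ → X, Bornology.IsBounded (range x) →
    Tendsto x atTop (@nhds X (lcTopology P) 0) → ∀ t₀, 0 ≤ t₀ →
      @TendstoUniformlyOn ℝ X ℕ (lcUniformity P) (fun n s => T s (x n)) (fun _ => 0) atTop
        (Icc 0 t₀)

variable {P : Set (Seminorm ℝ X)}

namespace BiContSemigroup

/-- `x` lies in the domain of the generator, with value `y`. -/
def GenRel (S : BiContSemigroup P) (x y : X) : Prop :=
  Tendsto (fun t : ℝ => t⁻¹ • (S.T t x - x)) (𝓝[>] 0) (@nhds X (lcTopology P) y) ∧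
    BddAbove ((fun t : ℝ => ‖S.T t x - x‖ / t) '' Ioc 0 1)

variable (S : BiContSemigroup P)

theorem GenRel.unique {S : BiContSemigroup P} {x y z : X} (h : S.GenRel x y)
    (h' : S.GenRel x z) : y = z := by
  let _ := lcTopology P
  have := S.space.t2
  exact tendsto_nhds_unique h.1 h'.1

theorem bddAbove_iff {x : X} : BddAbove ((fun t : ℝ => ‖S.T t x - x‖ / t) '' Ioc 0 1) ↔
    ∃ K, 0 ≤ K ∧ ∀ t, 0 < t → t ≤ 1 → ‖S.T t x - x‖ ≤ K * t := by
  constructor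
  · rintro ⟨K, hK⟩
    refine ⟨|K|, abs_nonneg _, fun t h0 h1 => ?_⟩
    have := hK ⟨t, ⟨h0, h1⟩, rfl⟩
    rw [← div_le_iff₀ h0]
    exact this.trans (le_abs_self K)
  · rintro ⟨K, -, hK⟩
    refine ⟨K, ?_⟩
    rintro _ ⟨t, ⟨h0, h1⟩, rfl⟩
    exact (div_le_iff₀ h0).2 (hK t h0 h1)

theorem GenRel.add {S : BiContSemigroup P} {x y x' y' : X} (h : S.GenRel x y)
    (h' : S.GenRel x' y') : S.GenRel (x + x') (y + y') := by
  refine ⟨?_, ?_⟩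
  · have h1 := tendsto_lcTopology.1 h.1
    have h2 := tendsto_lcTopology.1 h'.1
    refine tendsto_lcTopology.2 fun p hp => ?_
    refine squeeze_zero (fun _ => apply_nonneg _ _) (fun t => ?_)
      (by simpa using (h1 p hp).add (h2 p hp))
    have : t⁻¹ • (S.T t (x + x') - (x + x')) - (y + y')
        = (t⁻¹ • (S.T t x - x) - y) + (t⁻¹ • (S.T t x' - x') - y') := by
      rw [_root_.map_add]; module
    rw [this]
    exact map_add_le_add p _ _
  · obtain ⟨K, hK0, hK⟩ := S.bddAbove_iff.1 h.2
    obtain ⟨L, hL0, hL⟩ := S.bddAbove_iff.1 h'.2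
    refine S.bddAbove_iff.2 ⟨K + L, by positivity, fun t h0 h1 => ?_⟩
    have : S.T t (x + x') - (x + x') = (S.T t x - x) + (S.T t x' - x') := by
      rw [_root_.map_add]; abel
    rw [this, add_mul]
    exact (norm_add_le _ _).trans (add_le_add (hK t h0 h1) (hL t h0 h1))

theorem GenRel.smul {S : BiContSemigroup P} {x y : X} (c : ℝ) (h : S.GenRel x y) :
    S.GenRel (c • x) (c • y) := by
  have e : ∀ t, S.T t (c • x) - c • x = c • (S.T t x - x) := fun t => by
    rw [map_smul, smul_sub]
  refine ⟨?_, ?_⟩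
  · have h1 := tendsto_lcTopology.1 h.1
    refine tendsto_lcTopology.2 fun p hp => ?_
    have := (h1 p hp).const_mul ‖c‖
    rw [mul_zero] at this
    refine this.congr fun t => ?_
    rw [e, smul_comm, ← smul_sub, map_smul_eq_mul]
  · obtain ⟨K, hK0, hK⟩ := S.bddAbove_iff.1 h.2
    refine S.bddAbove_iff.2 ⟨‖c‖ * K, by positivity, fun t h0 h1 => ?_⟩
    rw [e, norm_smul, mul_assoc]
    exact mul_le_mul_of_nonneg_left (hK t h0 h1) (norm_nonneg _)

theorem genRel_zero : S.GenRel 0 0 := by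
  refine ⟨tendsto_lcTopology.2 fun p _ => by simp, S.bddAbove_iff.2 ⟨0, le_rfl, by simp⟩⟩

/-- The generator of a bi-continuous semigroup. -/
def generator : X →ₗ.[ℝ] X where
  domain :=
    { carrier := {x | ∃ y, S.GenRel x y}
      add_mem' := fun ⟨_, h⟩ ⟨_, h'⟩ => ⟨_, h.add h'⟩
      zero_mem' := ⟨0, S.genRel_zero⟩
      smul_mem' := fun c _ ⟨_, h⟩ => ⟨_, h.smul c⟩ }
  toFun :=
    { toFun := fun x => x.2.choose
      map_add' := fun x y => (x + y).2.choose_spec.unique (x.2.choose_spec.add y.2.choose_spec)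
      map_smul' := fun c x => (c • x).2.choose_spec.unique (x.2.choose_spec.smul c) }

theorem mem_domain_of_genRel {x y : X} (h : S.GenRel x y) : x ∈ S.generator.domain := ⟨y, h⟩

theorem generator_apply {x y : X} (h : S.GenRel x y) :
    S.generator ⟨x, S.mem_domain_of_genRel h⟩ = y :=
  (S.mem_domain_of_genRel h).choose_spec.unique h

end BiContSemigroup

/-- `B` is a bounded everywhere defined inverse of `A - μ`. -/
structure IsShiftedInverse (A : X →ₗ.[ℝ] X) (μ : ℝ) (B : X →L[ℝ] X) : Prop where
  mem : ∀ x, B x ∈ A.domain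
  right_inv : ∀ x, A ⟨B x, mem x⟩ - μ • B x = x
  left_inv : ∀ x : A.domain, B (A x - μ • (x : X)) = x

/-- The real part of the resolvent set: those real `μ` for which `A - μ` has a bounded inverse. -/
def realResolventSet (A : X →ₗ.[ℝ] X) : Set ℝ := {μ | ∃ B, IsShiftedInverse A μ B}

/-- The operator `(A - μ)⁻¹`. -/
def shiftedInverse (A : X →ₗ.[ℝ] X) {μ : ℝ} (hμ : μ ∈ realResolventSet A) : X →L[ℝ] X :=
  hμ.choose

theorem shiftedInverse_spec (A : X →ₗ.[ℝ] X) {μ : ℝ} (hμ : μ ∈ realResolventSet A) :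
    IsShiftedInverse A μ (shiftedInverse A hμ) := hμ.choose_spec

end Semigroups

/-! ### Extrapolation of a Banach space along an operator with dense range -/

section Extrapolation

variable {E : Type*} [NormedAddCommGroup E] [NormedSpace ℝ E]

/-- A copy of `E`, which carries the norm `x ↦ ‖L x‖`. -/
def ExtrapPre (_L : E →L[ℝ] E) : Type _ := E

instance (L : E →L[ℝ] E) : AddCommGroup (ExtrapPre L) := inferInstanceAs (AddCommGroup E)

instance (L : E →L[ℝ] E) : Module ℝ (ExtrapPre L) := inferInstanceAs (Module ℝ E)

/-- `L`, as a map on the copy of `E`. -/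
def ExtrapPre.map (L : E →L[ℝ] E) : ExtrapPre L →ₗ[ℝ] E := (L : E →ₗ[ℝ] E)

instance (L : E →L[ℝ] E) : SeminormedAddCommGroup (ExtrapPre L) :=
  SeminormedAddCommGroup.induced (ExtrapPre L) E (ExtrapPre.map L)

instance (L : E →L[ℝ] E) : NormedSpace ℝ (ExtrapPre L) :=
  NormedSpace.induced ℝ (ExtrapPre L) E (ExtrapPre.map L)

/-- The completion of `E` with respect to the norm `x ↦ ‖L x‖` (for an injective `L`). -/
abbrev Extrap (L : E →L[ℝ] E) : Type _ := UniformSpace.Completion (ExtrapPre L)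

/-- The canonical map from `E` to the completion. -/
def Extrap.coe (L : E →L[ℝ] E) : E →L[ℝ] Extrap L :=
  LinearMap.mkContinuous
    ((UniformSpace.Completion.toComplₗᵢ (𝕜 := ℝ) (E := ExtrapPre L)).toLinearMap : E →ₗ[ℝ] _)
    ‖L‖ (fun x => by
      have : ‖(UniformSpace.Completion.toComplₗᵢ (𝕜 := ℝ) (E := ExtrapPre L)) x‖ = ‖L x‖ :=
        LinearIsometry.norm_map _ _
      exact this.le.trans (L.le_opNorm x))

theorem Extrap.denseRange_coe (L : E →L[ℝ] E) : DenseRange (Extrap.coe L) :=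
  UniformSpace.Completion.denseRange_coe (α := ExtrapPre L)

theorem Extrap.norm_coe (L : E →L[ℝ] E) (x : E) : ‖Extrap.coe L x‖ = ‖L x‖ :=
  LinearIsometry.norm_map (UniformSpace.Completion.toComplₗᵢ (𝕜 := ℝ) (E := ExtrapPre L)) x

/-- For `L = G⁻¹`, the isometric isomorphism from `E` onto the extrapolation space that is the
continuous extension of the densely defined operator `G`. Its inverse is the continuous
extension of `L`. -/
def Extrap.op [CompleteSpace E] (L : E →L[ℝ] E) (hL : DenseRange L) : E ≃ₗᵢ[ℝ] Extrap L :=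
  ((LinearEquiv.refl ℝ E).extendOfIsometry (Extrap.coe L : E →ₗ[ℝ] Extrap L) (L : E →ₗ[ℝ] E)
    (Extrap.denseRange_coe L) hL (fun x => (Extrap.norm_coe L x).symm)).symm

theorem Extrap.op_symm_coe [CompleteSpace E] (L : E →L[ℝ] E) (hL : DenseRange L) (x : E) :
    (Extrap.op L hL).symm (Extrap.coe L x) = L x :=
  (LinearEquiv.refl ℝ E).extendOfIsometry_eq (Extrap.coe L : E →ₗ[ℝ] Extrap L)
    (L : E →ₗ[ℝ] E) (Extrap.denseRange_coe L) hL (fun x => (Extrap.norm_coe L x).symm) x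

theorem Extrap.op_apply [CompleteSpace E] (L : E →L[ℝ] E) (hL : DenseRange L) (x : E) :
    Extrap.op L hL (L x) = Extrap.coe L x := by
  rw [← Extrap.op_symm_coe L hL x, LinearIsometryEquiv.apply_symm_apply]

/-- The inverse of `Extrap.op`, as an operator on the extrapolation space. -/
def Extrap.inv [CompleteSpace E] (L : E →L[ℝ] E) (hL : DenseRange L) :
    Extrap L →L[ℝ] Extrap L :=
  Extrap.coe L ∘L ((Extrap.op L hL).symm.toContinuousLinearEquiv : Extrap L →L[ℝ] E)

theorem Extrap.denseRange_inv [CompleteSpace E] (L : E →L[ℝ] E) (hL : DenseRange L) :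
    DenseRange (Extrap.inv L hL) :=
  (Extrap.denseRange_coe L).comp (Extrap.op L hL).symm.surjective.denseRange
    (Extrap.coe L).continuous

end Extrapolation

/-! ### Extrapolation spaces of bi-continuous semigroups -/

section ExtrapolationSpaces

variable {X : Type*} [NormedAddCommGroup X] [NormedSpace ℝ X]
  {P : Set (Seminorm ℝ X)}

namespace BiContSemigroup

variable (S : BiContSemigroup P)

theorem lipschitz {x : X} (hx : x ∈ S.generator.domain) : ∃ C, 0 ≤ C ∧
    ∀ s t, 0 ≤ s → s ≤ t → t ≤ s + 1 → t ≤ 2 → ‖S.T t x - S.T s x‖ ≤ C * (t - s) := by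
  obtain ⟨y, hy⟩ := hx
  obtain ⟨K, hK0, hK⟩ := S.bddAbove_iff.1 hy.2
  obtain ⟨M, hM, ω, hω⟩ := S.expBounded
  refine ⟨M * Real.exp (|ω| * 2) * K, by positivity, fun s t h0 hst h1 h2 => ?_⟩
  rcases hst.eq_or_lt with rfl | hlt
  · simp
  have e : S.T t x - S.T s x = S.T s (S.T (t - s) x - x) := by
    have := S.map_add (t - s) s (by linarith) h0
    rw [add_sub_cancel] at this
    rw [this, map_sub]; rfl
  rw [e, mul_assoc]
  refine ((S.T s).le_opNorm _).trans (mul_le_mul ((hω s h0).trans ?_)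
    (hK _ (by linarith) (by linarith)) (norm_nonneg _) (by positivity))
  gcongr
  · exact le_abs_self ω
  · linarith

theorem continuousOn_norm {x : X} (hx : x ∈ S.generator.domain) :
    ContinuousOn (fun t => S.T t x) (Icc 0 2) := by
  obtain ⟨C, hC, h⟩ := S.lipschitz hx
  have key : ∀ s ∈ Icc (0 : ℝ) 2, ∀ t ∈ Icc (0 : ℝ) 2, |t - s| ≤ 1 →
      ‖S.T t x - S.T s x‖ ≤ C * |t - s| := by
    intro s hs t ht hst
    rcases le_total s t with hle | hle
    · rw [abs_of_nonneg (by linarith)] at hst ⊢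
      exact h s t hs.1 hle (by linarith) ht.2
    · rw [abs_of_nonpos (by linarith)] at hst ⊢
      rw [norm_sub_rev, neg_sub]
      exact h t s ht.1 hle (by linarith) hs.2
  intro s hs
  rw [ContinuousWithinAt, tendsto_iff_norm_sub_tendsto_zero]
  refine squeeze_zero' (Eventually.of_forall fun _ => norm_nonneg _) (g := fun t => C * |t - s|)
    ?_ ?_
  · have h1 : ∀ᶠ t in 𝓝[Icc 0 2] s, |t - s| < 1 :=
      nhdsWithin_le_nhds (Metric.ball_mem_nhds s one_pos)
    filter_upwards [h1, self_mem_nhdsWithin] with t h1 ht using key s hs t ht h1.le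
  · have : Continuous fun t : ℝ => C * |t - s| := by fun_prop
    simpa using (this.tendsto s).mono_left nhdsWithin_le_nhds

theorem genRel_of_norm {z y : X} {K : ℝ}
    (h : ∀ t, 0 < t → t ≤ 1 → ‖t⁻¹ • (S.T t z - z) - y‖ ≤ K * t) : S.GenRel z y := by
  refine ⟨?_, S.bddAbove_iff.2 ⟨|K| + ‖y‖, by positivity, fun t h0 h1 => ?_⟩⟩
  · have : Tendsto (fun t : ℝ => t⁻¹ • (S.T t z - z)) (𝓝[>] 0) (𝓝 y) := by
      rw [tendsto_iff_norm_sub_tendsto_zero]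
      refine squeeze_zero' (Eventually.of_forall fun _ => norm_nonneg _) (g := fun t => K * t)
        ?_ ?_
      · filter_upwards [Ioc_mem_nhdsGT (zero_lt_one' ℝ)] with t ht using h t ht.1 ht.2
      · have : Continuous fun t : ℝ => K * t := by fun_prop
        simpa using (this.tendsto 0).mono_left nhdsWithin_le_nhds
    exact this.mono_right (nhds_mono S.space.coarser)
  · have e : S.T t z - z = t • ((t⁻¹ • (S.T t z - z) - y) + y) := by
      rw [sub_add_cancel, smul_inv_smul₀ h0.ne']
    rw [e, norm_smul, Real.norm_of_nonneg h0.le, mul_comm]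
    gcongr
    refine (norm_add_le _ _).trans (add_le_add_left ((h t h0 h1).trans ?_) _)
    calc K * t ≤ |K| * t := by gcongr; exact le_abs_self K
      _ ≤ |K| * 1 := by gcongr
      _ = |K| := mul_one _

theorem genRel_mean [CompleteSpace X] {x : X} (hx : x ∈ S.generator.domain) {h : ℝ} (h0 : 0 < h) (h1 : h ≤ 1) :
    S.GenRel (∫ s in (0 : ℝ)..h, S.T s x) (S.T h x - x) := by
  obtain ⟨C, hC, hl⟩ := S.lipschitz hx
  have hc := S.continuousOn_norm hx
  have ii : ∀ a b, 0 ≤ a → a ≤ 2 → 0 ≤ b → b ≤ 2 →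
      IntervalIntegrable (fun s => S.T s x) MeasureTheory.volume a b := by
    intro a b ha ha' hb hb'
    refine (hc.mono ?_).intervalIntegrable
    exact uIcc_subset_Icc ⟨ha, ha'⟩ ⟨hb, hb'⟩
  have mean : ∀ a t, 0 ≤ a → a ≤ 1 → 0 < t → t ≤ 1 →
      ‖t⁻¹ • (∫ s in a..(a + t), S.T s x) - S.T a x‖ ≤ C * t := by
    intro a t ha ha' ht ht'
    have e : t⁻¹ • (∫ s in a..(a + t), S.T s x) - S.T a x
        = t⁻¹ • (∫ s in a..(a + t), (S.T s x - S.T a x)) := by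
      rw [intervalIntegral.integral_sub (ii _ _ ha (by linarith) (by linarith) (by linarith))
        (by simp), intervalIntegral.integral_const, add_sub_cancel_left, smul_sub,
        inv_smul_smul₀ ht.ne']
    rw [e, norm_smul, norm_inv, Real.norm_of_nonneg ht.le, inv_mul_le_iff₀ ht]
    have := intervalIntegral.norm_integral_le_of_norm_le_const (a := a) (b := a + t)
      (f := fun s => S.T s x - S.T a x) (C := C * t) (fun s hs => by
        rw [uIoc_of_le (by linarith)] at hs
        refine (hl a s ha hs.1.le (by linarith [hs.2]) (by linarith [hs.2])).trans ?_
        gcongr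
        linarith [hs.2])
    rw [add_sub_cancel_left, abs_of_pos ht] at this
    linarith
  refine S.genRel_of_norm (K := C + C) fun t ht ht' => ?_
  have e1 : S.T t (∫ s in (0 : ℝ)..h, S.T s x) = ∫ s in t..(t + h), S.T s x := by
    rw [← (S.T t).intervalIntegral_comp_comm (ii _ _ le_rfl (by norm_num) h0.le (by linarith))]
    have := intervalIntegral.integral_comp_add_left (a := 0) (b := h) (fun s => S.T s x) t
    rw [add_zero] at this
    rw [← this]
    refine intervalIntegral.integral_congr fun s hs => ?_
    rw [uIcc_of_le h0.le] at hs
    simp only [S.map_add s t hs.1 ht.le]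
    rfl
  have e2 : (∫ s in t..(t + h), S.T s x) - (∫ s in (0 : ℝ)..h, S.T s x)
      = (∫ s in h..(h + t), S.T s x) - ∫ s in (0 : ℝ)..(0 + t), S.T s x := by
    have a1 := intervalIntegral.integral_add_adjacent_intervals
      (ii 0 t le_rfl (by norm_num) ht.le (by linarith))
      (ii t (t + h) ht.le (by linarith) (by linarith) (by linarith))
    have a2 := intervalIntegral.integral_add_adjacent_intervals
      (ii 0 h le_rfl (by norm_num) h0.le (by linarith))
      (ii h (h + t) h0.le (by linarith) (by linarith) (by linarith))
    rw [zero_add]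
    rw [add_comm h t] at a2 ⊢
    rw [← eq_sub_iff_add_eq'] at a1 a2
    rw [a1, a2]
    abel
  rw [e1, e2]
  have e3 : t⁻¹ • ((∫ s in h..(h + t), S.T s x) - ∫ s in (0 : ℝ)..(0 + t), S.T s x)
      - (S.T h x - x) = (t⁻¹ • (∫ s in h..(h + t), S.T s x) - S.T h x)
      - (t⁻¹ • (∫ s in (0 : ℝ)..(0 + t), S.T s x) - S.T 0 x) := by
    rw [S.map_zero, ContinuousLinearMap.id_apply]; module
  rw [e3, add_mul]
  exact (norm_sub_le _ _).trans (add_le_add (mean h t h0.le h1 ht ht')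
    (mean 0 t le_rfl zero_le_one ht ht'))

theorem domain_invariant {x : X} (hx : x ∈ S.generator.domain) {s : ℝ} (hs : 0 ≤ s) :
    S.T s x ∈ S.generator.domain := by
  obtain ⟨y, hy⟩ := hx
  obtain ⟨K, hK0, hK⟩ := S.bddAbove_iff.1 hy.2
  have comm : ∀ t, 0 ≤ t → S.T t (S.T s x) - S.T s x = S.T s (S.T t x - x) := by
    intro t ht
    have e1 := S.map_add s t hs ht
    have e2 := S.map_add t s ht hs
    rw [add_comm] at e1
    rw [map_sub, ← ContinuousLinearMap.comp_apply, ← e1, e2]; rfl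
  refine ⟨S.T s y, ?_, S.bddAbove_iff.2 ⟨‖S.T s‖ * K, by positivity, fun t h0 h1 => ?_⟩⟩
  · refine tendsto_of_seq_tendsto fun u hu => ?_
    have hu' : ∀ᶠ n in atTop, u n ∈ Ioc (0 : ℝ) 1 :=
      hu.eventually (Ioc_mem_nhdsGT (zero_lt_one' ℝ))
    obtain ⟨N, hN⟩ := eventually_atTop.1 hu'
    have hv : ∀ n, u (n + N) ∈ Ioc (0 : ℝ) 1 := fun n => hN _ (by omega)
    let z : ℕ → X := fun n => (u (n + N))⁻¹ • (S.T (u (n + N)) x - x) - y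
    have hz0 : Tendsto z atTop (@nhds X (lcTopology P) 0) := by
      have := (hy.1.comp hu).comp (tendsto_add_atTop_nat N)
      refine tendsto_lcTopology.2 fun p hp => ?_
      simpa [z, Function.comp_def] using tendsto_lcTopology.1 this p hp
    have hzb : Bornology.IsBounded (range z) := by
      refine isBounded_iff_forall_norm_le.2 ⟨K + ‖y‖, ?_⟩
      rintro _ ⟨n, rfl⟩
      refine (norm_sub_le _ _).trans (add_le_add_left ?_ _)
      rw [norm_smul, norm_inv, Real.norm_of_nonneg (hv n).1.le, inv_mul_le_iff₀ (hv n).1, mul_comm]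
      exact hK _ (hv n).1 (hv n).2
    have hT := S.biEquicontinuous z hzb hz0 s hs
    have hT' : Tendsto (fun n => S.T s (z n)) atTop (@nhds X (lcTopology P) 0) := by
      let _ := lcUniformity P
      exact hT.tendsto_at ⟨hs, le_rfl⟩
    rw [← tendsto_add_atTop_iff_nat N]
    refine tendsto_lcTopology.2 fun p hp => ?_
    refine (tendsto_lcTopology.1 hT' p hp).congr fun n => ?_
    simp only [Function.comp_apply]
    rw [comm _ (hv n).1.le, sub_zero]
    simp only [z, map_sub, map_smul]
  · rw [comm t h0.le, mul_assoc]
    exact ((S.T s).le_opNorm _).trans (mul_le_mul_of_nonneg_left (hK t h0 h1) (norm_nonneg _))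

/-- The space of strong continuity: the norm closure of the domain of the generator. -/
def X₀ : Submodule ℝ X := S.generator.domain.topologicalClosure

instance [CompleteSpace X] : CompleteSpace S.X₀ :=
  S.generator.domain.isClosed_topologicalClosure.completeSpace_coe

variable {S} {μ : ℝ} (hμ : μ ∈ realResolventSet S.generator)

theorem shiftedInverse_mem (x : X) : shiftedInverse S.generator hμ x ∈ S.X₀ :=
  S.generator.domain.le_topologicalClosure ((shiftedInverse_spec S.generator hμ).mem x)

/-- The restriction of `(A - μ)⁻¹` to `X₀`. This is `(A₀ - μ)⁻¹`, where `A₀` is the part of the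
generator `A` in `X₀`. -/
def inv₀ : S.X₀ →L[ℝ] S.X₀ :=
  (shiftedInverse S.generator hμ ∘L S.X₀.subtypeL).codRestrict S.X₀
    fun x => shiftedInverse_mem hμ x

variable [CompleteSpace X]

theorem denseRange_inv₀ : DenseRange (inv₀ hμ) := by
  intro z
  rw [Metric.mem_closure_iff]
  intro ε hε
  obtain ⟨x, hx, hxz⟩ := Metric.mem_closure_iff.1 (show (z : X) ∈ closure
    (S.generator.domain : Set X) from z.2) (ε / 2) (by linarith)
  obtain ⟨C, hC, hl⟩ := S.lipschitz hx
  set h : ℝ := min 1 (ε / (2 * (C + 1))) with hh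
  have h0 : 0 < h := lt_min one_pos (by positivity)
  have h1 : h ≤ 1 := min_le_left _ _
  have hCh : C * h < ε / 2 := by
    have : h ≤ ε / (2 * (C + 1)) := min_le_right _ _
    rw [le_div_iff₀ (by positivity)] at this
    nlinarith
  have hm := S.genRel_mean hx h0 h1
  have hm' := hm.smul h⁻¹
  set w : X := h⁻¹ • ∫ s in (0 : ℝ)..h, S.T s x with hw
  have hwd : w ∈ S.generator.domain := S.mem_domain_of_genRel hm'
  have hAw : S.generator ⟨w, hwd⟩ ∈ S.generator.domain := by
    rw [S.generator_apply hm']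
    exact Submodule.smul_mem _ _ (Submodule.sub_mem _ (S.domain_invariant hx h0.le) hx)
  have hv : S.generator ⟨w, hwd⟩ - μ • w ∈ S.X₀ :=
    S.generator.domain.le_topologicalClosure
      (Submodule.sub_mem _ hAw (Submodule.smul_mem _ _ hwd))
  refine ⟨_, ⟨⟨_, hv⟩, rfl⟩, ?_⟩
  have hinv : ((inv₀ hμ ⟨_, hv⟩ : S.X₀) : X) = w :=
    (shiftedInverse_spec S.generator hμ).left_inv ⟨w, hwd⟩
  rw [Subtype.dist_eq, hinv]
  have hxw : ‖x - w‖ ≤ C * h := by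
    have hc := S.continuousOn_norm hx
    have ii : IntervalIntegrable (fun s => S.T s x) MeasureTheory.volume 0 h :=
      (hc.mono (uIcc_subset_Icc ⟨le_rfl, by norm_num⟩ ⟨h0.le, by linarith⟩)).intervalIntegrable
    have e : w - x = h⁻¹ • ∫ s in (0 : ℝ)..h, (S.T s x - x) := by
      rw [intervalIntegral.integral_sub ii (by simp), intervalIntegral.integral_const, sub_zero,
        smul_sub, inv_smul_smul₀ h0.ne']
    rw [norm_sub_rev, e, norm_smul, norm_inv, Real.norm_of_nonneg h0.le, inv_mul_le_iff₀ h0]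
    have := intervalIntegral.norm_integral_le_of_norm_le_const (a := 0) (b := h)
      (f := fun s => S.T s x - x) (C := C * h) (fun s hs => by
        rw [uIoc_of_le h0.le] at hs
        have := hl 0 s le_rfl hs.1.le (by linarith [hs.2]) (by linarith [hs.2])
        rw [S.map_zero, ContinuousLinearMap.id_apply, sub_zero] at this
        refine this.trans ?_
        gcongr
        exact hs.2)
    rw [sub_zero, abs_of_pos h0] at this
    linarith
  calc dist (z : X) w ≤ dist (z : X) x + dist x w := dist_triangle _ _ _
    _ < ε / 2 + ε / 2 := add_lt_add hxz (by rw [dist_eq_norm]; linarith)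
    _ = ε := by ring

/-- The first extrapolation space of the strongly continuous semigroup on `X₀`: the completion of
`X₀` with respect to the norm `x ↦ ‖(A₀ - μ)⁻¹ x‖`. -/
abbrev CX₁ : Type _ := Extrap (inv₀ hμ)

/-- `A₋₁ - μ`, as an isometric isomorphism from `X₀` onto the first extrapolation space: the
continuous extension of `A₀ - μ`. -/
def opC₁ : S.X₀ ≃ₗᵢ[ℝ] CX₁ hμ := Extrap.op (inv₀ hμ) (denseRange_inv₀ hμ)

/-- The second extrapolation space of the strongly continuous semigroup on `X₀`. -/
abbrev CX₂ : Type _ := Extrap (Extrap.inv (inv₀ hμ) (denseRange_inv₀ hμ))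

/-- `A₋₂ - μ`, as an isometric isomorphism from the first onto the second extrapolation space. -/
def opC₂ : CX₁ hμ ≃ₗᵢ[ℝ] CX₂ hμ :=
  Extrap.op (Extrap.inv (inv₀ hμ) (denseRange_inv₀ hμ))
    (Extrap.denseRange_inv (inv₀ hμ) (denseRange_inv₀ hμ))

/-- The embedding of `X` into the first extrapolation space, which sends `x` to
`(A₋₁ - μ) (A - μ)⁻¹ x` and extends the canonical embedding of `X₀`. -/
def incl₁ : X →ₗ[ℝ] CX₁ hμ :=
  (opC₁ hμ).toLinearEquiv.toLinearMap ∘ₗ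
    ((shiftedInverse S.generator hμ).codRestrict S.X₀ (shiftedInverse_mem hμ)).toLinearMap

theorem incl₁_coe (x : S.X₀) : incl₁ hμ x = Extrap.coe (inv₀ hμ) x :=
  Extrap.op_apply (inv₀ hμ) (denseRange_inv₀ hμ) x

theorem incl₁_injective : Function.Injective (incl₁ hμ) := by
  intro x y h
  have h1 : shiftedInverse S.generator hμ x = shiftedInverse S.generator hμ y :=
    congrArg Subtype.val ((opC₁ hμ).injective h)
  have hs := shiftedInverse_spec S.generator hμ
  rw [← hs.right_inv x, ← hs.right_inv y]
  simp only [h1]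

/-- The canonical embedding of the first into the second extrapolation space. -/
def incl₂ : CX₁ hμ →ₗ[ℝ] CX₂ hμ :=
  (Extrap.coe (Extrap.inv (inv₀ hμ) (denseRange_inv₀ hμ))).toLinearMap

/-- The extrapolation space `X₋₁ = (A₋₂ - μ)(X)` of the bi-continuous semigroup, where `X` is
regarded as a subspace of the first extrapolation space of `X₀`. -/
def X₁ : Submodule ℝ (CX₂ hμ) :=
  LinearMap.range ((opC₂ hμ).toLinearEquiv.toLinearMap ∘ₗ incl₁ hμ)

/-- The restriction of `A₋₂ - μ` to an isomorphism from `X` onto `X₋₁`. The norm of `X₋₁` is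
the one that makes it isometric. -/
def opX₁ : X ≃ₗ[ℝ] X₁ hμ :=
  LinearEquiv.ofInjective ((opC₂ hμ).toLinearEquiv.toLinearMap ∘ₗ incl₁ hμ)
    ((opC₂ hμ).injective.comp (incl₁_injective hμ))

theorem incl₂_incl₁_eq (x : X) :
    incl₂ hμ (incl₁ hμ x) = opC₂ hμ (incl₁ hμ (shiftedInverse S.generator hμ x)) := by
  have h : incl₁ hμ (shiftedInverse S.generator hμ x)
      = Extrap.inv (inv₀ hμ) (denseRange_inv₀ hμ) (incl₁ hμ x) := by
    have h2 : (opC₁ hμ).symm (incl₁ hμ x) = ⟨_, shiftedInverse_mem hμ x⟩ :=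
      (opC₁ hμ).symm_apply_apply _
    have h3 : Extrap.inv (inv₀ hμ) (denseRange_inv₀ hμ) (incl₁ hμ x)
      = Extrap.coe (inv₀ hμ) ((opC₁ hμ).symm (incl₁ hμ x)) := rfl
    rw [h3, h2]
    exact incl₁_coe hμ ⟨_, shiftedInverse_mem hμ x⟩
  rw [h]
  exact (Extrap.op_apply (Extrap.inv (inv₀ hμ) (denseRange_inv₀ hμ))
    (Extrap.denseRange_inv (inv₀ hμ) (denseRange_inv₀ hμ)) (incl₁ hμ x)).symm

/-- The embedding of `X` into `X₋₁`: the restriction of the canonical embedding of the first into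
the second extrapolation space of `X₀`. -/
def inclX₁ : X →ₗ[ℝ] X₁ hμ :=
  (incl₂ hμ ∘ₗ incl₁ hμ).codRestrict (X₁ hμ) fun x =>
    ⟨shiftedInverse S.generator hμ x, (incl₂_incl₁_eq hμ x).symm⟩

/-- The seminorms `p₋₁(z) = p((A₋₂ - μ)⁻¹ z)`, `p ∈ P`, which generate the topology `τ₋₁`
of `X₋₁`. -/
def seminorms₁ : Set (Seminorm ℝ (X₁ hμ)) :=
  (fun p : Seminorm ℝ X => p.comp (opX₁ hμ).symm.toLinearMap) '' P

/-- The mixed topology `γ₋₁` of `X₋₁`. -/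
@[reducible]
def mixedTopology₁ : TopologicalSpace (X₁ hμ) := mixedTopology (seminorms₁ hμ)

end BiContSemigroup

end ExtrapolationSpaces

/-! ### Positivity -/

section Positivity

variable {X : Type*} [NormedAddCommGroup X] [NormedSpace ℝ X] [Lattice X]
  {P : Set (Seminorm ℝ X)}

/-- The topology generated by `P` is compatible with the lattice structure. -/
def IsCompatible (P : Set (Seminorm ℝ X)) : Prop :=
  ∀ p ∈ P, ∀ x y : X, |x| ≤ |y| → p x ≤ p y

namespace BiContSemigroup

/-- All operators of the semigroup are positive. -/
def IsPositive (S : BiContSemigroup P) : Prop := ∀ t, 0 ≤ t → ∀ x, 0 ≤ x → 0 ≤ S.T t x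

/-- The semigroup is locally equicontinuous for the mixed topology. -/
def IsMixedEquicontinuous (S : BiContSemigroup P) : Prop :=
  ∃ t₀ : ℝ, 0 < t₀ ∧ ∀ p ∈ mixedSeminorms P, ∃ q ∈ mixedSeminorms P, ∃ M : ℝ, 0 ≤ M ∧
    ∀ x, ∀ t ∈ Icc 0 t₀, p (S.T t x) ≤ M * q x

/-- The set of positive elements of `X₋₁`: the closure of the positive cone of `X` for the mixed
topology of `X₋₁`. -/
def positiveSet [CompleteSpace X] {S : BiContSemigroup P} {μ : ℝ}
    (hμ : μ ∈ realResolventSet S.generator) : Set (X₁ hμ) :=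
  @closure (X₁ hμ) (mixedTopology₁ hμ) (inclX₁ hμ '' {x : X | 0 ≤ x})

end BiContSemigroup

end Positivity

end BiCont

end

/-! Write `R t = e^{-μt} T(t)` for the rescaled semigroup, whose generator is `A - μ`, and pull an
element `z` of `X₋₁` back to `u = (A₋₂ - μ)⁻¹ z` in `X`. For `z = x` in `X` this is `u = (A - μ)⁻¹
x`. The proof replaces positivity of `z` by a condition on `u` that lives in `X`: `R t u ≥ u` for
all small `t > 0`.

If `z = x ≥ 0` lies in `X`, then formally `R t u - u = ∫₀ᵗ R s x ds ≥ 0`. Since orbits are only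
`τ`-continuous, the integral is replaced by a telescoping sum of difference quotients. Their
negative parts are norm-bounded and `τ`-null, so bi-equicontinuity makes their contribution vanish
(`IsPositive.le_rescaled_of_genRel`). For each fixed small `t`, local equicontinuity makes `T(t)`
`γ`-continuous, so the condition is `γ`-closed in `u` and passes to all of `X₋₁,₊`
(`le_rescaled_of_tendsto`, `IsPositive.exists_le_rescaled_of_mem_positiveSet`).

Both nontrivial claims follow. If `z` and `-z` are positive, then `R t u = u` for small `t`, hence
for all `t ≥ 0`, so `(A - μ) u = 0` and `u = 0` (`eq_zero_of_rescaled_eq`). If `z = x` lies in `X`,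
then `x = (A - μ) u` is the `τ`-limit of the positive elements `t⁻¹ (R t u - u)`, hence positive
(`nonneg_of_le_rescaled`). Neither the sign of `(A - μ)⁻¹` nor the size of `μ` plays a role. -/

namespace BiCont

open Filter Topology Set

/-! ### Topologies generated by seminorms and their mixed topologies -/

section Seminorms

variable {E : Type*} [AddCommGroup E] [Module ℝ E]

/-- The weights `1, 0, 0, …` recover `p`. Thus `γ` is finer than `τ`, and `γ`-limits are `τ`-limits.
-/
theorem subset_mixedSeminorms (P : Set (Seminorm ℝ E)) : P ⊆ mixedSeminorms P := by
  intro p hp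
  refine ⟨fun n => if n = 0 then 1 else 0, fun _ => p, fun n => by positivity, ?_, fun _ => hp,
    fun x => ⟨?_, fun b hb => ?_⟩⟩
  · refine tendsto_const_nhds.congr' ?_
    filter_upwards [eventually_ne_atTop 0] with n hn using (if_neg hn).symm
  · rintro _ ⟨n, rfl⟩
    by_cases hn : n = 0
    · simp [hn]
    · simp [hn]
  · simpa using hb ⟨0, rfl⟩

theorem mixedSeminorms_comp {F : Type*} [AddCommGroup F] [Module ℝ F] {P : Set (Seminorm ℝ E)}
    (L : F →ₗ[ℝ] E) {q : Seminorm ℝ E} (hq : q ∈ mixedSeminorms P) :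
    q.comp L ∈ mixedSeminorms ((fun p : Seminorm ℝ E => p.comp L) '' P) := by
  obtain ⟨a, p, ha, ha0, hp, hl⟩ := hq
  exact ⟨a, fun n => (p n).comp L, ha, ha0, fun n => ⟨p n, hp n, rfl⟩, fun x => hl (L x)⟩

/-- Forming mixed seminorms commutes with pulling back along `L`. With `L = (A₋₂ - μ)⁻¹` this
carries `γ₋₁`-limits to `γ`-limits. -/
theorem tendsto_mixedTopology_comp {F : Type*} [AddCommGroup F] [Module ℝ F]
    (P : Set (Seminorm ℝ E)) (L : F →ₗ[ℝ] E) (z : F) :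
    Tendsto L (@nhds F (mixedTopology ((fun p : Seminorm ℝ E => p.comp L) '' P)) z)
      (@nhds E (mixedTopology P) (L z)) := by
  refine tendsto_lcTopology.2 fun q hq => ?_
  refine (tendsto_lcTopology.1 tendsto_id _ (mixedSeminorms_comp L hq)).congr fun w => ?_
  rw [Seminorm.comp_apply, map_sub]
  rfl

theorem continuousAdd_lcTopology (P : Set (Seminorm ℝ E)) :
    @ContinuousAdd E (lcTopology P) _ := by
  let _ := lcTopology P
  refine ⟨continuous_iff_continuousAt.2 fun x => tendsto_lcTopology.2 fun p hp => ?_⟩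
  have h1 := tendsto_lcTopology.1 (continuous_fst.tendsto x) p hp
  have h2 := tendsto_lcTopology.1 (continuous_snd.tendsto x) p hp
  refine squeeze_zero (fun _ => apply_nonneg _ _) (fun z => ?_) (by simpa using h1.add h2)
  rw [add_sub_add_comm]
  exact map_add_le_add p _ _

theorem continuousConstSMul_lcTopology (P : Set (Seminorm ℝ E)) :
    @ContinuousConstSMul ℝ E (lcTopology P) _ := by
  let _ := lcTopology P
  refine ⟨fun c => continuous_iff_continuousAt.2 fun x => tendsto_lcTopology.2 fun p hp => ?_⟩
  have h := (tendsto_lcTopology.1 (continuous_id.tendsto x) p hp).const_mul ‖c‖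
  rw [mul_zero] at h
  refine h.congr fun z => ?_
  rw [← smul_sub, map_smul_eq_mul]; rfl

theorem eq_zero_of_forall_seminorm {P : Set (Seminorm ℝ E)} (h : @T2Space E (lcTopology P))
    {x : E} (hx : ∀ p ∈ P, p x = 0) : x = 0 := by
  let _ := lcTopology P
  have h1 : Tendsto (fun _ : ℕ => x) atTop (𝓝 0) :=
    tendsto_lcTopology.2 fun p hp => by simp [hx p hp]
  exact tendsto_nhds_unique tendsto_const_nhds h1

theorem eventually_lt_of_tendstoUniformlyOn {P : Set (Seminorm ℝ E)} {ι α : Type*} {l : Filter ι}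
    {s : Set α} {F : ι → α → E}
    (h : @TendstoUniformlyOn α E ι (lcUniformity P) F (fun _ => 0) l s)
    {p : Seminorm ℝ E} (hp : p ∈ P) {ε : ℝ} (hε : 0 < ε) :
    ∀ᶠ i in l, ∀ a ∈ s, p (F i a) < ε := by
  have hle : lcUniformity P ≤ p.toSeminormedAddCommGroup.toUniformSpace :=
    iInf_le (fun p : P => (p : Seminorm ℝ E).toSeminormedAddCommGroup.toUniformSpace) ⟨p, hp⟩
  let _ := p.toSeminormedAddCommGroup
  filter_upwards [h _ (hle (Metric.dist_mem_uniformity hε))] with i hi a ha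
  have h1 : dist (0 : E) (F i a) < ε := hi a ha
  rw [dist_zero_left] at h1
  exact h1

end Seminorms

/-! ### Negative parts and the closedness of the positive cone -/

section Lattice

variable {X : Type*} [NormedAddCommGroup X] [NormedSpace ℝ X] [Lattice X] [IsOrderedAddMonoid X]
  {P : Set (Seminorm ℝ X)}

theorem IsCompatible.le_of_nonneg (hP : IsCompatible P) {p : Seminorm ℝ X} (hp : p ∈ P) {a b : X}
    (ha : 0 ≤ a) (hab : a ≤ b) : p a ≤ p b :=
  hP p hp a b (by rwa [abs_of_nonneg ha, abs_of_nonneg (ha.trans hab)])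

theorem IsCompatible.negPart_add_le (hP : IsCompatible P) {p : Seminorm ℝ X} (hp : p ∈ P)
    (a b : X) : p (a + b)⁻ ≤ p a⁻ + p b⁻ := by
  refine (hP.le_of_nonneg hp (negPart_nonneg _) ?_).trans (map_add_le_add p _ _)
  rw [negPart_def, neg_add]
  exact sup_le (add_le_add (neg_le_negPart a) (neg_le_negPart b))
    (add_nonneg (negPart_nonneg a) (negPart_nonneg b))

omit [NormedSpace ℝ X] in
theorem abs_negPart_le_abs (a : X) : |a⁻| ≤ |a| := by
  rw [abs_of_nonneg (negPart_nonneg a)]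
  exact sup_le (neg_le_abs a) (abs_nonneg a)

theorem IsCompatible.negPart_le (hP : IsCompatible P) {p : Seminorm ℝ X} (hp : p ∈ P) (a : X) :
    p a⁻ ≤ p a :=
  hP p hp _ _ (abs_negPart_le_abs a)

/-- Split `a = b + (a - b)`: only the second summand contributes a negative part. The size of `a⁻`
is thus controlled by the distance from `a` to the cone, which makes the cone `τ`-closed. -/
theorem IsCompatible.negPart_le_sub (hP : IsCompatible P) {p : Seminorm ℝ X} (hp : p ∈ P)
    {a b : X} (hb : 0 ≤ b) : p a⁻ ≤ p (a - b) := by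
  have h := hP.negPart_add_le hp b (a - b)
  rw [add_sub_cancel, negPart_eq_zero.2 hb, map_zero, zero_add] at h
  exact h.trans (hP.negPart_le hp _)

theorem nonneg_of_forall_negPart_le (h : @T2Space X (lcTopology P))
    {x : X} (hx : ∀ p ∈ P, p x⁻ ≤ 0) : 0 ≤ x :=
  negPart_eq_zero.1 (eq_zero_of_forall_seminorm h fun p hp =>
    le_antisymm (hx p hp) (apply_nonneg _ _))

theorem IsCompatible.nonneg_of_tendsto (hP : IsCompatible P) (h : @T2Space X (lcTopology P))
    {ι : Type*} {l : Filter ι} [l.NeBot] {f : ι → X} {x : X}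
    (hf : Tendsto f l (@nhds X (lcTopology P) x)) (h0 : ∀ᶠ i in l, 0 ≤ f i) : 0 ≤ x := by
  refine nonneg_of_forall_negPart_le h fun p hp => ge_of_tendsto (tendsto_lcTopology.1 hf p hp) ?_
  filter_upwards [h0] with i hi
  rw [map_sub_rev]
  exact hP.negPart_le_sub hp hi

end Lattice

/-! ### Scalar estimates for the exponential factor -/

theorem tendsto_inv_mul_exp_sub_one (μ : ℝ) :
    Tendsto (fun t : ℝ => t⁻¹ * (Real.exp (μ * t) - 1)) (𝓝[>] 0) (𝓝 μ) := by
  have h : HasDerivAt (fun t : ℝ => Real.exp (μ * t)) μ 0 := by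
    simpa using ((hasDerivAt_id (0 : ℝ)).const_mul μ).exp
  simpa [slope_fun_def] using (hasDerivAt_iff_tendsto_slope.1 h).mono_left
    (nhdsWithin_mono 0 fun t ht => (mem_Ioi.1 ht).ne')

theorem abs_exp_mul_sub_one_le (μ : ℝ) {t : ℝ} (h0 : 0 ≤ t) (h1 : t ≤ 1) :
    |Real.exp (μ * t) - 1| ≤ |μ| * Real.exp |μ| * t := by
  have h2 : |μ * t| ≤ |μ| * t := by rw [abs_mul, abs_of_nonneg h0]
  have h3 : |μ| * t ≤ |μ| * Real.exp |μ| * t := by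
    gcongr
    exact le_mul_of_one_le_right (abs_nonneg _) (Real.one_le_exp (abs_nonneg _))
  have h4 : Real.exp (μ * t) ≤ Real.exp |μ| := Real.exp_le_exp.2
    ((le_abs_self _).trans (h2.trans (mul_le_of_le_one_right (abs_nonneg _) h1)))
  rw [abs_le]
  constructor
  · have := Real.add_one_le_exp (μ * t)
    have := neg_abs_le (μ * t)
    linarith
  -- Multiplying `1 - s ≤ e^{-s}` by `e^s` gives `e^s - 1 ≤ s e^s`, here with `s = μ t`.
  · have h5 := Real.add_one_le_exp (-(μ * t))
    have h6 : Real.exp (-(μ * t)) * Real.exp (μ * t) = 1 := by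
      rw [← Real.exp_add, neg_add_cancel, Real.exp_zero]
    have h7 : Real.exp (μ * t) - 1 ≤ μ * t * Real.exp (μ * t) := by
      nlinarith [Real.exp_pos (μ * t)]
    calc Real.exp (μ * t) - 1 ≤ μ * t * Real.exp (μ * t) := h7
      _ ≤ |μ| * t * Real.exp |μ| :=
        mul_le_mul ((le_abs_self _).trans h2) h4 (Real.exp_pos _).le (by positivity)
      _ = _ := by ring

namespace BiContSemigroup

/-! ### The rescaled semigroup and its fixed points -/

section Rescaled

variable {X : Type*} [NormedAddCommGroup X] [NormedSpace ℝ X] {P : Set (Seminorm ℝ X)}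
  (S : BiContSemigroup P) (μ : ℝ)

/-- The rescaled semigroup `e^{-μt} T(t)`. -/
noncomputable def rescaled (t : ℝ) : X →L[ℝ] X := Real.exp (-μ * t) • S.T t

theorem rescaled_apply (t : ℝ) (x : X) : S.rescaled μ t x = Real.exp (-μ * t) • S.T t x := rfl

theorem rescaled_add {s t : ℝ} (hs : 0 ≤ s) (ht : 0 ≤ t) (x : X) :
    S.rescaled μ (t + s) x = S.rescaled μ t (S.rescaled μ s x) := by
  simp only [rescaled_apply, S.map_add s t hs ht, map_smul, smul_smul, mul_add, Real.exp_add,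
    ContinuousLinearMap.comp_apply]
  rw [mul_comm]

theorem rescaled_zero (x : X) : S.rescaled μ 0 x = x := by
  simp [rescaled_apply, S.map_zero]

variable {S}

theorem GenRel.tendsto_rescaled {x y : X} (h : S.GenRel x y) :
    Tendsto (fun t : ℝ => t⁻¹ • (S.rescaled μ t x - x)) (𝓝[>] 0)
      (@nhds X (lcTopology P) (y - μ • x)) := by
  refine tendsto_lcTopology.2 fun p hp => ?_
  have h1 := tendsto_lcTopology.1 h.1 p hp
  have he : Tendsto (fun t : ℝ => Real.exp (-μ * t)) (𝓝[>] 0) (𝓝 1) := by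
    have : Continuous fun t : ℝ => Real.exp (-μ * t) := by fun_prop
    simpa using (this.tendsto 0).mono_left nhdsWithin_le_nhds
  have hlim : Tendsto (fun t : ℝ => Real.exp (-μ * t) * p (t⁻¹ • (S.T t x - x) - y)
      + |Real.exp (-μ * t) - 1| * p y + |t⁻¹ * (Real.exp (-μ * t) - 1) + μ| * p x)
      (𝓝[>] 0) (𝓝 0) := by
    have := ((he.mul h1).add ((he.sub_const 1).abs.mul_const (p y))).add
      (((tendsto_inv_mul_exp_sub_one (-μ)).add_const μ).abs.mul_const (p x))
    simpa using this
  refine squeeze_zero (fun _ => apply_nonneg _ _) (fun t => ?_) hlim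
  -- Product rule for `e^{-μt} · T(t) x`: each of the three summands tends to zero.
  have e : t⁻¹ • (S.rescaled μ t x - x) - (y - μ • x)
      = Real.exp (-μ * t) • (t⁻¹ • (S.T t x - x) - y) + (Real.exp (-μ * t) - 1) • y
        + (t⁻¹ * (Real.exp (-μ * t) - 1) + μ) • x := by
    rw [rescaled_apply]; module
  rw [e]
  refine (map_add_le_add p _ _).trans (add_le_add ((map_add_le_add p _ _).trans
    (add_le_add ?_ ?_)) ?_)
  · rw [map_smul_eq_mul, Real.norm_of_nonneg (Real.exp_pos _).le]
  · rw [map_smul_eq_mul, Real.norm_eq_abs]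
  · rw [map_smul_eq_mul, Real.norm_eq_abs]

/-- Bi-equicontinuity applies only to norm-bounded sequences; this supplies the bound for the
difference quotients. -/
theorem GenRel.exists_norm_rescaled_le {x y : X} (h : S.GenRel x y) :
    ∃ K, ∀ t, 0 < t → t ≤ 1 → ‖t⁻¹ • (S.rescaled μ t x - x)‖ ≤ K := by
  obtain ⟨K, hK0, hK⟩ := S.bddAbove_iff.1 h.2
  refine ⟨Real.exp |μ| * K + |μ| * Real.exp |μ| * ‖x‖, fun t h0 h1 => ?_⟩
  have e : S.rescaled μ t x - x
      = Real.exp (-μ * t) • (S.T t x - x) + (Real.exp (-μ * t) - 1) • x := by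
    rw [rescaled_apply]; module
  have he := abs_exp_mul_sub_one_le (-μ) h0.le h1
  rw [abs_neg] at he
  have he' : Real.exp (-μ * t) ≤ Real.exp |μ| := by
    refine Real.exp_le_exp.2 ?_
    calc -μ * t ≤ |μ| * t := by gcongr; exact neg_le_abs μ
      _ ≤ |μ| := mul_le_of_le_one_right (abs_nonneg _) h1
  rw [norm_smul, norm_inv, Real.norm_of_nonneg h0.le, inv_mul_le_iff₀ h0, e]
  refine (norm_add_le _ _).trans ?_
  rw [norm_smul, norm_smul, Real.norm_of_nonneg (Real.exp_pos _).le, Real.norm_eq_abs]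
  calc _ ≤ Real.exp |μ| * (K * t) + |μ| * Real.exp |μ| * t * ‖x‖ := by
        gcongr
        exact hK t h0 h1
    _ = _ := by ring

variable {μ}

/-- By the semigroup law, `t` is reached in `n` steps of length `t / n ≤ δ`, each of which fixes
`x`. -/
theorem rescaled_eq_of_forall_le {x : X} {δ : ℝ} (hδ : 0 < δ)
    (h : ∀ t, 0 < t → t ≤ δ → S.rescaled μ t x = x) {t : ℝ} (ht : 0 ≤ t) :
    S.rescaled μ t x = x := by
  obtain ⟨n, hn⟩ := exists_nat_gt (t / δ)
  have hn0 : (0 : ℝ) < n := (div_nonneg ht hδ.le).trans_lt hn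
  rcases ht.eq_or_lt with rfl | ht'
  · exact S.rescaled_zero μ x
  have hs : 0 < t / n := by positivity
  have hsδ : t / n ≤ δ := by
    rw [div_lt_iff₀ hδ] at hn
    rw [div_le_iff₀ hn0]
    linarith
  have key : ∀ k : ℕ, S.rescaled μ (k * (t / n)) x = x := by
    intro k
    induction k with
    | zero => simp [S.rescaled_zero]
    | succ k ih =>
      rw [Nat.cast_succ, add_mul, one_mul, S.rescaled_add μ hs.le (by positivity), h _ hs hsδ, ih]
  simpa [mul_div_cancel₀ _ hn0.ne'] using key n

/-- Here `T(t) x = e^{μt} x`, so the difference quotients are scalar multiples of `x` and both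
conditions on the domain become estimates for the exponential. -/
theorem genRel_of_rescaled_eq {x : X} (h : ∀ t, 0 ≤ t → S.rescaled μ t x = x) :
    S.GenRel x (μ • x) := by
  have hT : ∀ t, 0 ≤ t → S.T t x = Real.exp (μ * t) • x := by
    intro t ht
    have := h t ht
    rw [rescaled_apply] at this
    conv_rhs => rw [← this]
    rw [smul_smul, ← Real.exp_add, neg_mul, add_neg_cancel, Real.exp_zero, one_smul]
  refine ⟨tendsto_lcTopology.2 fun p _ => ?_, S.bddAbove_iff.2
    ⟨|μ| * Real.exp |μ| * ‖x‖, by positivity, fun t h0 h1 => ?_⟩⟩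
  · have hl := ((tendsto_inv_mul_exp_sub_one μ).sub_const μ).abs.mul_const (p x)
    rw [sub_self, abs_zero, zero_mul] at hl
    refine hl.congr' ?_
    filter_upwards [self_mem_nhdsWithin] with t (ht : 0 < t)
    have e : t⁻¹ • (S.T t x - x) - μ • x = (t⁻¹ * (Real.exp (μ * t) - 1) - μ) • x := by
      rw [hT t ht.le]; module
    rw [e, map_smul_eq_mul, Real.norm_eq_abs]
  · have e : S.T t x - x = (Real.exp (μ * t) - 1) • x := by
      rw [hT t h0.le]; module
    rw [e, norm_smul, Real.norm_eq_abs]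
    calc _ ≤ |μ| * Real.exp |μ| * t * ‖x‖ := by
          gcongr
          exact abs_exp_mul_sub_one_le μ h0.le h1
      _ = _ := by ring

/-- Such an `x` would be an eigenvector of `A` for `μ`, but `A - μ` is injective. -/
theorem eq_zero_of_rescaled_eq (hμ : μ ∈ realResolventSet S.generator) {x : X} {δ : ℝ}
    (hδ : 0 < δ) (h : ∀ t, 0 < t → t ≤ δ → S.rescaled μ t x = x) : x = 0 := by
  have hx := genRel_of_rescaled_eq fun t ht => rescaled_eq_of_forall_le hδ h ht
  have := (shiftedInverse_spec S.generator hμ).left_inv ⟨x, S.mem_domain_of_genRel hx⟩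
  rw [S.generator_apply hx, sub_self, _root_.map_zero] at this
  exact this.symm

theorem genRel_shiftedInverse (hμ : μ ∈ realResolventSet S.generator) (x : X) :
    S.GenRel (shiftedInverse S.generator hμ x) (x + μ • shiftedInverse S.generator hμ x) := by
  have hs := shiftedInverse_spec S.generator hμ
  obtain ⟨y, hy⟩ := hs.mem x
  have h := hs.right_inv x
  rw [S.generator_apply hy, sub_eq_iff_eq_add] at h
  rwa [← h]

end Rescaled

/-! ### Positivity of `(A - μ) x` in terms of the orbit of `x` -/

section Positive

variable {X : Type*} [NormedAddCommGroup X] [NormedSpace ℝ X] [Lattice X] [IsOrderedAddMonoid X]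
  [IsOrderedModule ℝ X] {P : Set (Seminorm ℝ X)} {S : BiContSemigroup P} {μ : ℝ}

omit [IsOrderedAddMonoid X] in
theorem IsPositive.rescaled_nonneg (hS : S.IsPositive) {t : ℝ} (ht : 0 ≤ t) {x : X} (hx : 0 ≤ x) :
    0 ≤ S.rescaled μ t x :=
  smul_nonneg (Real.exp_pos _).le (hS t ht x hx)

theorem IsPositive.negPart_rescaled_le (hS : S.IsPositive) {t : ℝ} (ht : 0 ≤ t) (x : X) :
    (S.rescaled μ t x)⁻ ≤ S.rescaled μ t x⁻ := by
  refine sup_le ?_ (hS.rescaled_nonneg ht (negPart_nonneg x))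
  rw [← map_neg, ← sub_nonneg, ← map_sub]
  exact hS.rescaled_nonneg ht (sub_nonneg.2 (neg_le_negPart x))

/-- A discrete form of `R t x - x = ∫₀ᵗ R s (A - μ) x ds`: the increment over `k` steps telescopes
to `h ∑_{j<k} R (j h) z`, and positivity bounds the negative part of each term by `h R (j h) z⁻`.
The factor `e^{|μ|}` absorbs `e^{-μ j h}`, as `j h ≤ 1`. -/
theorem IsPositive.negPart_rescaled_sub_le (hS : S.IsPositive) (hP : IsCompatible P)
    {p : Seminorm ℝ X} (hp : p ∈ P) {x z : X} {h ε : ℝ} (h0 : 0 ≤ h)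
    (hz : S.rescaled μ h x - x = h • z) (hε : ∀ s ∈ Icc (0 : ℝ) 1, p (S.T s z⁻) ≤ ε) (k : ℕ)
    (hk : k * h ≤ 1) :
    p (S.rescaled μ (k * h) x - x)⁻ ≤ k * h * (Real.exp |μ| * ε) := by
  induction k with
  | zero => simp [S.rescaled_zero]
  | succ k ih =>
    rw [Nat.cast_succ, add_mul, one_mul] at hk ⊢
    have hkh : 0 ≤ k * h := by positivity
    have hk1 : k * h ≤ 1 := by linarith
    have e : S.rescaled μ (k * h + h) x - x
        = (S.rescaled μ (k * h) x - x) + h • S.rescaled μ (k * h) z := by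
      rw [← map_smul, ← hz, map_sub, ← S.rescaled_add μ h0 hkh]
      abel
    rw [e, add_mul]
    refine (hP.negPart_add_le hp _ _).trans (add_le_add (ih hk1) ?_)
    have hle : (h • S.rescaled μ (k * h) z)⁻ ≤ h • S.rescaled μ (k * h) z⁻ := by
      refine sup_le ?_ (smul_nonneg h0 (hS.rescaled_nonneg hkh (negPart_nonneg z)))
      rw [← smul_neg]
      exact smul_le_smul_of_nonneg_left
        ((neg_le_negPart _).trans (hS.negPart_rescaled_le hkh z)) h0
    refine (hP.le_of_nonneg hp (negPart_nonneg _) hle).trans ?_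
    rw [rescaled_apply, map_smul_eq_mul, map_smul_eq_mul, Real.norm_of_nonneg h0,
      Real.norm_of_nonneg (Real.exp_pos _).le]
    have he : Real.exp (-μ * (k * h)) ≤ Real.exp |μ| := by
      refine Real.exp_le_exp.2 ?_
      calc -μ * (k * h) ≤ |μ| * (k * h) := by gcongr; exact neg_le_abs μ
        _ ≤ |μ| := mul_le_of_le_one_right (abs_nonneg _) hk1
    gcongr
    exact hε _ ⟨hkh, hk1⟩

-- For a fixed `t`, equicontinuity makes `R t - 1` continuous from `γ` to `τ`, and the positive cone
-- is `τ`-closed.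
omit [IsOrderedModule ℝ X] in
theorem le_rescaled_of_tendsto (hP : IsCompatible P) {t₀ : ℝ}
    (hequi : ∀ p ∈ mixedSeminorms P, ∃ q ∈ mixedSeminorms P, ∃ M : ℝ, 0 ≤ M ∧
      ∀ x, ∀ t ∈ Icc 0 t₀, p (S.T t x) ≤ M * q x)
    {t : ℝ} (ht : t ∈ Icc 0 t₀) {ι : Type*} {l : Filter ι} [l.NeBot] {f : ι → X} {x : X}
    (hf : Tendsto f l (@nhds X (mixedTopology P) x))
    (h : ∀ᶠ i in l, 0 ≤ S.rescaled μ t (f i) - f i) : 0 ≤ S.rescaled μ t x - x := by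
  have hlim := tendsto_lcTopology.1 hf
  refine hP.nonneg_of_tendsto S.space.t2 (tendsto_lcTopology.2 fun p hp => ?_) h
  have hp' := subset_mixedSeminorms P hp
  obtain ⟨q, hqP, M, -, hM⟩ := hequi p hp'
  have hl := (((hlim q hqP).const_mul M).const_mul (Real.exp (-μ * t))).add (hlim p hp')
  rw [mul_zero, mul_zero, add_zero] at hl
  refine squeeze_zero (fun _ => apply_nonneg _ _) (fun w => ?_) hl
  rw [sub_sub_sub_comm, ← map_sub]
  refine (map_sub_le_add p _ _).trans (add_le_add_left ?_ _)
  rw [rescaled_apply, map_smul_eq_mul, Real.norm_of_nonneg (Real.exp_pos _).le]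
  exact mul_le_mul_of_nonneg_left (hM _ t ht) (Real.exp_pos _).le

variable [HasSolidNorm X]

/-- If `(A - μ) x ≥ 0`, then the orbit of `x` under the rescaled semigroup lies above `x`. -/
theorem IsPositive.le_rescaled_of_genRel (hS : S.IsPositive) (hP : IsCompatible P) {x y : X}
    (h : S.GenRel x y) (hy : 0 ≤ y - μ • x) {t : ℝ} (h0 : 0 < t) (h1 : t ≤ 1) :
    0 ≤ S.rescaled μ t x - x := by
  -- The interval `[0, t]` is cut into `n + 1` equal steps, so that `t` itself is a grid point.
  let u : ℕ → ℝ := fun n => t / (n + 1)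
  have hu0 : ∀ n, 0 < u n := fun n => by positivity
  have hu1 : ∀ n, u n ≤ 1 := fun n =>
    (div_le_self h0.le (by linarith [n.cast_nonneg (α := ℝ)])).trans h1
  have hu : Tendsto u atTop (𝓝[>] 0) := by
    refine tendsto_nhdsWithin_iff.2 ⟨?_, Eventually.of_forall hu0⟩
    simpa [u, div_eq_mul_inv] using tendsto_one_div_add_atTop_nhds_zero_nat.const_mul t
  let z : ℕ → X := fun n => (u n)⁻¹ • (S.rescaled μ (u n) x - x)
  -- The quotients `z n` converge in `τ` to `y - μ • x ≥ 0`, so their negative parts are `τ`-null;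
  -- solidity of the norm keeps them norm-bounded.
  have hz : Tendsto (fun n => (z n)⁻) atTop (@nhds X (lcTopology P) 0) := by
    refine tendsto_lcTopology.2 fun p hp => ?_
    refine squeeze_zero (fun _ => apply_nonneg _ _) (fun n => ?_)
      (tendsto_lcTopology.1 ((h.tendsto_rescaled μ).comp hu) p hp)
    rw [sub_zero]
    exact hP.negPart_le_sub hp hy
  have hzb : Bornology.IsBounded (range fun n => (z n)⁻) := by
    obtain ⟨K, hK⟩ := h.exists_norm_rescaled_le μ
    refine isBounded_iff_forall_norm_le.2 ⟨K, ?_⟩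
    rintro _ ⟨n, rfl⟩
    exact (HasSolidNorm.solid (abs_negPart_le_abs (z n))).trans (hK _ (hu0 n) (hu1 n))
  have hunif := S.biEquicontinuous _ hzb hz 1 zero_le_one
  refine nonneg_of_forall_negPart_le S.space.t2 fun p hp => le_of_forall_pos_le_add fun δ hδ => ?_
  -- With this tolerance the telescoping estimate gives `t * δ ≤ δ`.
  obtain ⟨n, hn⟩ := (eventually_lt_of_tendstoUniformlyOn hunif hp
    (show 0 < δ / Real.exp |μ| by positivity)).exists
  have hnt : ((n + 1 : ℕ) : ℝ) * u n = t := by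
    simp only [u, Nat.cast_succ]
    field_simp
  have key := hS.negPart_rescaled_sub_le (μ := μ) hP hp (hu0 n).le
    (smul_inv_smul₀ (hu0 n).ne' _).symm (fun s hs => (hn s hs).le) (n + 1) (by rwa [hnt])
  rw [hnt, mul_div_cancel₀ _ (Real.exp_pos _).ne'] at key
  rw [zero_add]
  exact key.trans (mul_le_of_le_one_left hδ.le h1)

-- The difference quotients at zero are positive and tend in `τ` to `y - μ • x`.
omit [HasSolidNorm X] in
theorem nonneg_of_le_rescaled (hP : IsCompatible P) {x y : X} (h : S.GenRel x y) {δ : ℝ}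
    (hδ : 0 < δ) (hx : ∀ t, 0 < t → t ≤ δ → 0 ≤ S.rescaled μ t x - x) : 0 ≤ y - μ • x := by
  refine hP.nonneg_of_tendsto S.space.t2 (h.tendsto_rescaled μ) ?_
  filter_upwards [Ioc_mem_nhdsGT hδ] with t ht
  exact smul_nonneg (inv_nonneg.2 ht.1.le) (hx t ht.1 ht.2)

/-! ### Transfer to the extrapolation space -/

variable [CompleteSpace X] (hμ : μ ∈ realResolventSet S.generator)

omit [Lattice X] [IsOrderedAddMonoid X] [IsOrderedModule ℝ X] [HasSolidNorm X] in
theorem opX₁_symm_inclX₁ (x : X) :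
    (opX₁ hμ).symm (inclX₁ hμ x) = shiftedInverse S.generator hμ x := by
  rw [LinearEquiv.symm_apply_eq]
  exact Subtype.ext (incl₂_incl₁_eq hμ x)

omit [Lattice X] [IsOrderedAddMonoid X] [IsOrderedModule ℝ X] [HasSolidNorm X] in
theorem tendsto_opX₁_symm (z : X₁ hμ) :
    Tendsto (opX₁ hμ).symm (@nhds _ (mixedTopology₁ hμ) z)
      (@nhds X (mixedTopology P) ((opX₁ hμ).symm z)) :=
  tendsto_mixedTopology_comp P (opX₁ hμ).symm.toLinearMap z

theorem IsPositive.exists_le_rescaled_of_mem_positiveSet (hS : S.IsPositive)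
    (hP : IsCompatible P) (hequi : S.IsMixedEquicontinuous) :
    ∃ δ : ℝ, 0 < δ ∧ ∀ z ∈ positiveSet hμ, ∀ t, 0 < t → t ≤ δ →
      0 ≤ S.rescaled μ t ((opX₁ hμ).symm z) - (opX₁ hμ).symm z := by
  obtain ⟨t₀, ht₀, hq⟩ := hequi
  -- `t₀` is the range of equicontinuity; `1` is the range in which the orbit estimate holds on the
  -- cone of `X`.
  refine ⟨min t₀ 1, lt_min ht₀ one_pos, fun z hz t h0 ht => ?_⟩
  have hne : (@nhdsWithin _ (mixedTopology₁ hμ) z (inclX₁ hμ '' {x : X | 0 ≤ x})).NeBot :=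
    (@mem_closure_iff_nhdsWithin_neBot _ (mixedTopology₁ hμ) _ _).1 hz
  refine le_rescaled_of_tendsto hP hq ⟨h0.le, ht.trans (min_le_left _ _)⟩
    ((tendsto_opX₁_symm hμ z).mono_left
      (@nhdsWithin_le_nhds _ (mixedTopology₁ hμ) z (inclX₁ hμ '' {x : X | 0 ≤ x}))) ?_
  refine mem_of_superset (@self_mem_nhdsWithin _ (mixedTopology₁ hμ) _ _) ?_
  rintro _ ⟨x, hx, rfl⟩
  rw [mem_ofPred_eq, opX₁_symm_inclX₁]
  exact hS.le_rescaled_of_genRel hP (genRel_shiftedInverse hμ x)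
    (by rwa [add_sub_cancel_right]) h0 (ht.trans (min_le_right _ _))

omit [HasSolidNorm X] in
/-- The set of positive elements of `X₋₁`, as a convex cone. -/
theorem exists_convexCone_eq_positiveSet :
    ∃ K : ConvexCone ℝ (X₁ hμ), (K : Set (X₁ hμ)) = positiveSet hμ := by
  let _ := mixedTopology₁ hμ
  have := continuousAdd_lcTopology (mixedSeminorms (seminorms₁ hμ))
  have := continuousConstSMul_lcTopology (mixedSeminorms (seminorms₁ hμ))
  let K : ConvexCone ℝ X :=
    { carrier := {x | 0 ≤ x}
      smul_mem' := fun _ hc _ hx => smul_nonneg (le_of_lt hc) hx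
      add_mem' := fun _ hx _ hy => add_nonneg hx hy }
  exact ⟨(K.map (inclX₁ hμ)).closure, by rw [ConvexCone.coe_closure, ConvexCone.coe_map]; rfl⟩

end Positive

end BiContSemigroup

end BiCont

theorem mainTheorem3 {X : Type*} [NormedAddCommGroup X] [NormedSpace ℝ X] [CompleteSpace X]
    [Lattice X] [IsOrderedAddMonoid X] [IsOrderedModule ℝ X] [HasSolidNorm X]
    (P : Set (Seminorm ℝ X)) (hP : ∃ C : ℝ, ∀ p ∈ P, ∀ x, p x ≤ C * ‖x‖)
    (hcomp : BiCont.IsCompatible P)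
    (hcomplete : @CompleteSpace X (BiCont.mixedUniformity P))
    (S : BiCont.BiContSemigroup P) (hpos : S.IsPositive) (hequi : S.IsMixedEquicontinuous)
    (μ : ℝ) (hμ : μ ∈ BiCont.realResolventSet S.generator) :
    IsClosed[BiCont.BiContSemigroup.mixedTopology₁ hμ]
        (BiCont.BiContSemigroup.positiveSet hμ) ∧
      (∃ K : ConvexCone ℝ (BiCont.BiContSemigroup.X₁ hμ),
        (K : Set (BiCont.BiContSemigroup.X₁ hμ)) = BiCont.BiContSemigroup.positiveSet hμ ∧
          K.Pointed ∧ K.Salient) ∧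
      BiCont.BiContSemigroup.inclX₁ hμ '' {x : X | 0 ≤ x} =
        BiCont.BiContSemigroup.positiveSet hμ ∩ Set.range (BiCont.BiContSemigroup.inclX₁ hμ) := by
  have hsub : BiCont.BiContSemigroup.inclX₁ hμ '' {x : X | 0 ≤ x} ⊆
      BiCont.BiContSemigroup.positiveSet hμ :=
    @subset_closure _ (BiCont.BiContSemigroup.mixedTopology₁ hμ) _
  obtain ⟨δ, hδ, hle⟩ := hpos.exists_le_rescaled_of_mem_positiveSet hμ hcomp hequi
  refine ⟨@isClosed_closure _ (BiCont.BiContSemigroup.mixedTopology₁ hμ) _, ?_, ?_⟩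
  · obtain ⟨K, hK⟩ := BiCont.BiContSemigroup.exists_convexCone_eq_positiveSet hμ
    have hK' : ∀ z, z ∈ K ↔ z ∈ BiCont.BiContSemigroup.positiveSet hμ := fun z => by
      rw [← hK, SetLike.mem_coe]
    -- A `ConvexCone` is closed only under positive scalars; pointedness adds the scalar `0`, and
    -- salience is the trivial intersection with the negative.
    refine ⟨K, hK, (hK' 0).2 (hsub ⟨0, le_rfl, map_zero _⟩), fun z hz hz0 hnz => hz0 ?_⟩
    rw [← (BiCont.BiContSemigroup.opX₁ hμ).symm.map_eq_zero_iff]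
    refine BiCont.BiContSemigroup.eq_zero_of_rescaled_eq hμ hδ fun t h0 ht => ?_
    have h1 := hle z ((hK' z).1 hz) t h0 ht
    have h2 := hle (-z) ((hK' _).1 hnz) t h0 ht
    -- The inequality for `-z` is the reverse of the one for `z`, so the pull-back of `z` is fixed
    -- for times up to `δ`.
    rw [map_neg, map_neg, neg_sub_neg] at h2
    exact le_antisymm (sub_nonneg.1 h2) (sub_nonneg.1 h1)
  · refine Set.Subset.antisymm (Set.subset_inter hsub (Set.image_subset_range _ _)) ?_
    rintro _ ⟨hz, x, rfl⟩
    refine ⟨x, ?_, rfl⟩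
    -- The pull-back of `x` is `(A - μ)⁻¹ x`, which lies in the domain, so its orbit can be
    -- differentiated at zero and returns `x`.
    have h := BiCont.BiContSemigroup.nonneg_of_le_rescaled hcomp
      (BiCont.BiContSemigroup.genRel_shiftedInverse hμ x) hδ
      (by simpa only [BiCont.BiContSemigroup.opX₁_symm_inclX₁] using hle _ hz)
    rwa [add_sub_cancel_right] at h
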